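/- Let $\mathfrak g$ be a finite-dimensional real semisimple Lie algebra with an involutive automorphism $\sigma$, let $\mathfrak g=\mathfrak p\oplus\mathfrak k$ with $\mathfrak p=\{x:\sigma x=-x\}$, $\mathfrak k=\{x:\sigma x=x\}$, and let $\langle\,,\rangle$ be a nonzero scalar multiple of the Killing form that is positive definite on $\mathfrak k$. (This is the Lie algebra data of a symmetric Riemannian pair $(G,K)$ with $G$ semisimple and $K$ compact.) Write $x=x_{\mathfrak p}+x_{\mathfrak k}$, and for $s\in\{0,1\}$ put $$[x,y]_s=[x_{\mathfrak k},y_{\mathfrak p}]-[y_{\mathfrak k},x_{\mathfrak p}]+[x_{\mathfrak k},y_{\mathfrak k}]+s\,[x_{\mathfrak p},y_{\mathfrak p}],$$ so that $[\,,]_1=[\,,]$ is the semisimple bracket and $[\,,]_0$ is the bracket of the semidirect product $\mathfrak p\rtimes\mathfrak k$. Let $\{F,G\}_s(l)=l([dF_l,dG_l]_s)$ be the corresponding Lie–Poisson bracket on $\mathfrak g^*$, where $dF_l\in\mathfrak g\cong\mathfrak g^{**}$, and identify $l\in\mathfrak g^*$ with $L\in\mathfrak g$ by $l=\langle L,\cdot\rangle$.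 Fix $A\in\mathfrak p$, and for $\lambda\in\mathbb R$ let $$L_\lambda=L_{\mathfrak p}-\lambda L_{\mathfrak k}+(\lambda^2-s)A .$$ By spectral invariants of $L_\lambda$ we mean the functions $L\mapsto f(L_\lambda)$, where $f:\mathfrak g\to\mathbb R$ is one of the following: the real or imaginary part of a coefficient of the characteristic polynomial of $\rho(X)$, as a function of $X$, for a finite-dimensional complex matrix representation $\rho$ of $\mathfrak g$; a $C^\infty$ function such that $f(X)$ depends only on the characteristic polynomial of $\rho(X)$ for some such $\rho$; a Casimir of $\mathfrak g$ (a $C^\infty$ function on $\mathfrak g^*\cong\mathfrak g$ that Poisson commutes with every $C^\infty$ function for $\{\,,\}_1$). Let $$H(L)=\tfrac12\langle L_{\mathfrak k},L_{\mathfrak k}\rangle+\langle A,L_{\mathfrak p}\rangle$$ be the affine Hamiltonian. Then, in the semisimple case $s=1$ and in the semidirect case $s=0$: 1. For all $\lambda,\mu\in\mathbb R$, every spectral invariant of $L_\lambda$ and every spectral invariant of $L_\mu$ Poisson commute with respect to $\{\,,\}_s$. Likewise, if $C,C'$ are Casimirs of $\{\,,\}_s$, then $L\mapsto C(L_\lambda)$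 and $L\mapsto C'(L_\mu)$ Poisson commute with respect to $\{\,,\}_s$. 2. Every spectral invariant of $L_\lambda$ Poisson commutes with $H$ with respect to $\{\,,\}_s$. 3. Let $l(t)=\langle L(t),\cdot\rangle$, $t$ in an open interval, be an integral curve of the Hamiltonian field of $H$, that is, $\frac{d}{dt}\,l(t)(X)=-l(t)([dH_{l(t)},X]_s)$ for all $X\in\mathfrak g$. Then for every $\lambda\ne0$ $$\frac{dL_\lambda}{dt}=[M_\lambda,L_\lambda],\qquad M_\lambda=\frac1\lambda\,(L_{\mathfrak p}-sA),$$ and for every $\lambda\in\mathbb R$ every spectral invariant of $L_\lambda$ is constant along the curve. -/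

import Mathlib

open scoped ContDiff

/-! ### Functions on the dual of a finite-dimensional Lie algebra -/

section LiePoisson

/-- `C^∞` real functions on a finite-dimensional real vector space, read in linear coordinates
(the choice of the basis does not matter). -/
def IsSmoothFun {V : Type*} [AddCommGroup V] [Module ℝ V] [FiniteDimensional ℝ V]
    (f : V → ℝ) : Prop :=
  ContDiff ℝ ∞ (fun x : Fin (Module.finrank ℝ V) → ℝ =>
    f ((Module.finBasis ℝ V).equivFun.symm x))

/-- The differential at `l` of a function on `V*`, considered as an element of `V ≃ V**`:
in linear coordinates, `dF_l = ∑ᵢ (∂F/∂lᵢ)(l) bᵢ`, where `lᵢ = l(bᵢ)`.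
For a smooth function `F` this is the vector with `ξ(dF_l) = d/dt F(l + tξ)` at `t = 0` for all
`ξ ∈ V*`, whatever the basis. -/
noncomputable def dualDifferential {V : Type*} [AddCommGroup V] [Module ℝ V]
    [FiniteDimensional ℝ V] (F : Module.Dual ℝ V → ℝ) (l : Module.Dual ℝ V) : V :=
  ∑ i, lineDeriv ℝ F l ((Module.finBasis ℝ V).coord i) • (Module.finBasis ℝ V) i

/-- The Lie–Poisson bracket `{F, G}(l) = l([dF_l, dG_l])` on `V*` for a bracket `br` on `V`. -/
noncomputable def liePoisson {V : Type*} [AddCommGroup V] [Module ℝ V]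
    [FiniteDimensional ℝ V] (br : V → V → V) (F G : Module.Dual ℝ V → ℝ)
    (l : Module.Dual ℝ V) : ℝ :=
  l (br (dualDifferential F l) (dualDifferential G l))

/-- Casimirs: smooth functions that Poisson commute with every smooth function. -/
def IsCasimir {V : Type*} [AddCommGroup V] [Module ℝ V] [FiniteDimensional ℝ V]
    (br : V → V → V) (C : Module.Dual ℝ V → ℝ) : Prop :=
  IsSmoothFun C ∧
    ∀ G : Module.Dual ℝ V → ℝ, IsSmoothFun G → ∀ l, liePoisson br C G l = 0

/-- `l` is, on the set `I` of times, an integral curve of the Hamiltonian field of `H`: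
`dl/dt = -ad*(dH_l)(l)`, where `ad*(Y)(l) = l ∘ ad Y`. -/
def IsHamiltonianCurve {V : Type*} [AddCommGroup V] [Module ℝ V] [FiniteDimensional ℝ V]
    (br : V → V → V) (H : Module.Dual ℝ V → ℝ) (I : Set ℝ) (l : ℝ → Module.Dual ℝ V) : Prop :=
  ∀ t ∈ I, ∀ X : V,
    HasDerivAt (fun τ => l τ X) (-(l t (br (dualDifferential H (l t)) X))) t

end LiePoisson

/-! ### Symmetric pairs -/

/-- The Lie algebra data of a symmetric pair `(G, K)` with `G` semisimple and `K` compact: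
an involutive automorphism `σ` of the Lie algebra, and a scalar multiple `⟨ , ⟩` of the Killing
form that is positive definite on the fixed subalgebra `𝔨` of `σ`. -/
structure SymmetricPair (L : Type*) [LieRing L] [LieAlgebra ℝ L] [FiniteDimensional ℝ L] where
  /-- the involution -/
  σ : L ≃ₗ⁅ℝ⁆ L
  involutive : ∀ x, σ (σ x) = x
  /-- `⟨x, y⟩ = scale * killingForm x y` -/
  scale : ℝ
  scale_ne_zero : scale ≠ 0
  pos_on_k : ∀ x, σ x = x → x ≠ 0 → 0 < scale * killingForm ℝ L x x

namespace SymmetricPair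

section

variable {L : Type*} [LieRing L] [LieAlgebra ℝ L] [FiniteDimensional ℝ L]

/-- The projection of `x` on `𝔨 = {x | σ x = x}` along `𝔭`. -/
noncomputable def projK (D : SymmetricPair L) (x : L) : L := (1 / 2 : ℝ) • (x + D.σ x)

/-- The projection of `x` on `𝔭 = {x | σ x = -x}` along `𝔨`. -/
noncomputable def projP (D : SymmetricPair L) (x : L) : L := (1 / 2 : ℝ) • (x - D.σ x)

theorem projP_add_projK (D : SymmetricPair L) (x : L) : D.projP x + D.projK x = x := by
  rw [projP, projK, ← smul_add, sub_add_add_cancel, ← two_smul ℝ x, smul_smul]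
  norm_num

theorem σ_projK (D : SymmetricPair L) (x : L) : D.σ (D.projK x) = D.projK x := by
  simp [projK, D.involutive, add_comm]

theorem σ_projP (D : SymmetricPair L) (x : L) : D.σ (D.projP x) = -D.projP x := by
  simp [projP, D.involutive, ← smul_neg]

/-- The bracket
`[A₁ + B₁, A₂ + B₂]_s = [B₁, A₂] - [B₂, A₁] + [B₁, B₂] + s [A₁, A₂]`, `Aᵢ ∈ 𝔭`, `Bᵢ ∈ 𝔨`, on the
vector space `𝔭 ⊕ 𝔨`. For `s = 0` it is the bracket of the semidirect product `𝔭 ⋊ 𝔨`, and for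
`s = 1` the given bracket (see `deformedBracket_one`). -/
noncomputable def deformedBracket (D : SymmetricPair L) (s : ℝ) (x y : L) : L :=
  ⁅D.projK x, D.projP y⁆ - ⁅D.projK y, D.projP x⁆ + ⁅D.projK x, D.projK y⁆
    + s • ⁅D.projP x, D.projP y⁆

theorem deformedBracket_one (D : SymmetricPair L) (x y : L) :
    D.deformedBracket 1 x y = ⁅x, y⁆ := by
  conv_rhs => rw [← D.projP_add_projK x, ← D.projP_add_projK y]
  rw [deformedBracket, add_lie, lie_add, lie_add, one_smul, ← lie_skew (D.projK y)]
  abel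

/-- The form `⟨ , ⟩`. -/
noncomputable def form (D : SymmetricPair L) : LinearMap.BilinForm ℝ L :=
  D.scale • killingForm ℝ L

theorem form_nondegenerate [LieAlgebra.IsSemisimple ℝ L] (D : SymmetricPair L) :
    D.form.Nondegenerate :=
  have h := LieAlgebra.IsKilling.killingForm_nondegenerate ℝ L
  ⟨fun x hx => h.1 x fun y => (mul_eq_zero.mp (hx y)).resolve_left D.scale_ne_zero,
    fun y hy => h.2 y fun x => (mul_eq_zero.mp (hy x)).resolve_left D.scale_ne_zero⟩

/-- The identification `L* ≃ L`, `l ↦ X`, where `⟨X, Y⟩ = l(Y)` for all `Y`. -/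
noncomputable def sharp [LieAlgebra.IsSemisimple ℝ L] (D : SymmetricPair L) :
    Module.Dual ℝ L ≃ₗ[ℝ] L :=
  (D.form.toDual D.form_nondegenerate).symm

theorem form_sharp [LieAlgebra.IsSemisimple ℝ L] (D : SymmetricPair L) (l : Module.Dual ℝ L)
    (Y : L) : D.form (D.sharp l) Y = l Y := by
  rw [sharp, ← LinearMap.BilinForm.toDual_def (B := D.form) D.form_nondegenerate,
    LinearEquiv.apply_symm_apply]

/-- `L_μ = X_𝔭 - μ X_𝔨 + (μ² - s) A` at the point `X`. -/
noncomputable def spectralMatrix (D : SymmetricPair L) (A : L) (s μ : ℝ) (X : L) : L :=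
  D.projP X - μ • D.projK X + (μ ^ 2 - s) • A

/-- `M_μ = (1/μ) (X_𝔭 - s A)` at the point `X`. -/
noncomputable def laxMatrix (D : SymmetricPair L) (A : L) (s μ : ℝ) (X : L) : L :=
  μ⁻¹ • (D.projP X - s • A)

/-- The affine Hamiltonian `H = ½ ⟨X_𝔨, X_𝔨⟩ + ⟨A, X_𝔭⟩`, as a function on `L*` through the
identification of `L*` with `L`. -/
noncomputable def affineHamiltonian [LieAlgebra.IsSemisimple ℝ L] (D : SymmetricPair L) (A : L)
    (l : Module.Dual ℝ L) : ℝ :=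
  1 / 2 * D.form (D.projK (D.sharp l)) (D.projK (D.sharp l)) + D.form A (D.projP (D.sharp l))

/-- `ρ` is a representation of the Lie algebra `L` by complex matrices. -/
def IsMatrixRep {n : ℕ} (ρ : L →ₗ[ℝ] Matrix (Fin n) (Fin n) ℂ) : Prop :=
  ∀ X Y, ρ ⁅X, Y⁆ = ρ X * ρ Y - ρ Y * ρ X

/-- The functions of `X ∈ L` that count as spectral invariants of `X`: the (real and imaginary
parts of the) coefficients of the characteristic polynomial of `X` in any finite-dimensional
matrix representation; more generally the smooth functions that depend only on the spectrum, with
multiplicities, of `X` in such a representation; and the Casimirs of `L`. -/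
inductive IsSpectralInvariant (D : SymmetricPair L) : (L → ℝ) → Prop
  | coeff_re (n : ℕ) (ρ : L →ₗ[ℝ] Matrix (Fin n) (Fin n) ℂ) (hρ : IsMatrixRep ρ)
      (k : ℕ) :
      IsSpectralInvariant D (fun X => ((ρ X).charpoly.coeff k).re)
  | coeff_im (n : ℕ) (ρ : L →ₗ[ℝ] Matrix (Fin n) (Fin n) ℂ) (hρ : IsMatrixRep ρ)
      (k : ℕ) :
      IsSpectralInvariant D (fun X => ((ρ X).charpoly.coeff k).im)
  | spectrum (n : ℕ) (ρ : L →ₗ[ℝ] Matrix (Fin n) (Fin n) ℂ) (hρ : IsMatrixRep ρ)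
      (f : L → ℝ) (smooth : IsSmoothFun f)
      (inv : ∀ X Y, (ρ X).charpoly = (ρ Y).charpoly → f X = f Y) :
      IsSpectralInvariant D f
  | casimir (C : Module.Dual ℝ L → ℝ) (hC : IsCasimir (fun x y : L => ⁅x, y⁆) C) :
      IsSpectralInvariant D (fun X => C (D.form X))

/-- The function `l ↦ f(L_μ)` on `L*`. -/
noncomputable def spectralFunction [LieAlgebra.IsSemisimple ℝ L] (D : SymmetricPair L) (A : L)
    (s μ : ℝ) (f : L → ℝ) (l : Module.Dual ℝ L) : ℝ :=
  f (D.spectralMatrix A s μ (D.sharp l))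

end

end SymmetricPair

/-! Let `Z` be the gradient at `L_μ` of an invariant function `f`. Invariance says `⟨L_μ, [Z, U]⟩ =
0` for all `U`, and splitting `U` along `𝔭 ⊕ 𝔨` gives two scalar identities
(`IsInvariant.lie_projP`, `IsInvariant.lie_projK`). The linear part of `L ↦ L_μ` is symmetric for
the form, so `l ↦ f(L_μ)` has differential `Z_𝔭 - μ Z_𝔨`.

For two functions, at `μ` and `ν`, each identity is tested on the components of the other gradient.
In the four resulting equations the pairings with `A` can be eliminated, which leaves `(μ² - ν²) {F,
G}_s = 0`. The case `μ² = ν²` follows by continuity in `μ`.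

The same two identities, tested on `A` and `L_𝔨`, give `{F, H}_s = 0`, because `dH = L_𝔨 + A`. No
division by `μ` occurs, so conservation also holds at `μ = 0`, where there is no Lax pair. The Lax
equation itself is a direct computation with the invariant form.

A parameter `r` treats both kinds of invariants at once: `r = 1` for spectral invariants, `r = s`
for Casimirs of `[ , ]_s`. All that is needed is `s r = s`. -/

/-! ### Calculus of smooth functions in linear coordinates -/

section Calculus

variable {V W : Type*} [AddCommGroup V] [Module ℝ V] [FiniteDimensional ℝ V]
  [AddCommGroup W] [Module ℝ W] [FiniteDimensional ℝ W]

/-- The differential at `x` of a function on a finite-dimensional real vector space, computed in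
linear coordinates. -/
noncomputable def differential (f : V → ℝ) (x : V) : Module.Dual ℝ V :=
  (fderiv ℝ (fun y : Fin (Module.finrank ℝ V) → ℝ => f ((Module.finBasis ℝ V).equivFun.symm y))
    ((Module.finBasis ℝ V).equivFun x)).toLinearMap ∘ₗ (Module.finBasis ℝ V).equivFun.toLinearMap

theorem hasDerivAt_equivFun {c : ℝ → V} {v : V} {t : ℝ}
    (hc : ∀ ξ : Module.Dual ℝ V, HasDerivAt (fun τ => ξ (c τ)) (ξ v) t) :
    HasDerivAt (fun τ => (Module.finBasis ℝ V).equivFun (c τ))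
      ((Module.finBasis ℝ V).equivFun v) t :=
  hasDerivAt_pi.2 fun i => hc ((Module.finBasis ℝ V).coord i)

theorem continuous_equivFun {c : ℝ → V}
    (hc : ∀ ξ : Module.Dual ℝ V, Continuous fun τ => ξ (c τ)) :
    Continuous fun τ => (Module.finBasis ℝ V).equivFun (c τ) :=
  continuous_pi fun i => hc ((Module.finBasis ℝ V).coord i)

theorem IsSmoothFun.hasDerivAt_comp {f : V → ℝ} (hf : IsSmoothFun f) {c : ℝ → V} {v : V} {t : ℝ}
    (hc : ∀ ξ : Module.Dual ℝ V, HasDerivAt (fun τ => ξ (c τ)) (ξ v) t) :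
    HasDerivAt (fun τ => f (c τ)) (differential f (c t) v) t := by
  have h := ((ContDiff.differentiable hf (by simp))
    ((Module.finBasis ℝ V).equivFun (c t))).hasFDerivAt.comp_hasDerivAt t (hasDerivAt_equivFun hc)
  simpa [Function.comp_def, differential] using h

theorem IsSmoothFun.continuous_differential {f : V → ℝ} (hf : IsSmoothFun f) {c : ℝ → V}
    (hc : ∀ ξ : Module.Dual ℝ V, Continuous fun τ => ξ (c τ)) (v : V) :
    Continuous fun τ => differential f (c τ) v :=
  ((ContDiff.continuous_fderiv hf (by simp)).comp (continuous_equivFun hc)).clm_apply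
    continuous_const

theorem IsSmoothFun.comp_linearMap {f : V → ℝ} (hf : IsSmoothFun f) (φ : W →ₗ[ℝ] V) :
    IsSmoothFun fun x => f (φ x) := by
  have h : ContDiff ℝ ∞ ((Module.finBasis ℝ V).equivFun.toLinearMap ∘ₗ φ ∘ₗ
      (Module.finBasis ℝ W).equivFun.symm.toLinearMap).toContinuousLinearMap :=
    ContinuousLinearMap.contDiff _
  have h' := ContDiff.comp hf h
  simp only [Function.comp_def, LinearMap.coe_toContinuousLinearMap', LinearMap.comp_apply,
    LinearEquiv.coe_coe, LinearEquiv.symm_apply_apply] at h'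
  exact h'

theorem isSmoothFun_dual (φ : Module.Dual ℝ V) : IsSmoothFun fun x => φ x :=
  (φ ∘ₗ (Module.finBasis ℝ V).equivFun.symm.toLinearMap).toContinuousLinearMap.contDiff

theorem hasDerivAt_dual_line {V : Type*} [AddCommGroup V] [Module ℝ V] (x v : V) (ξ : Module.Dual ℝ V) (t : ℝ) :
    HasDerivAt (fun τ : ℝ => ξ (x + τ • v)) (ξ v) t := by
  simpa using ((hasDerivAt_id t).mul_const (ξ v)).const_add (ξ x)

theorem IsSmoothFun.lineDeriv_eq {f : V → ℝ} (hf : IsSmoothFun f) (x v : V) :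
    lineDeriv ℝ f x v = differential f x v := by
  have h := hf.hasDerivAt_comp (t := 0) (hasDerivAt_dual_line x v · 0)
  simpa [lineDeriv] using h.deriv

theorem dualDifferential_eq {F : Module.Dual ℝ V → ℝ} {l : Module.Dual ℝ V} {z : V}
    (h : ∀ ξ : Module.Dual ℝ V, lineDeriv ℝ F l ξ = ξ z) : dualDifferential F l = z := by
  simp only [dualDifferential, h]
  exact (Module.finBasis ℝ V).sum_repr z

theorem apply_dualDifferential {F : Module.Dual ℝ V → ℝ} (hF : IsSmoothFun F)
    (l ξ : Module.Dual ℝ V) : ξ (dualDifferential F l) = differential F l ξ := by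
  conv_rhs => rw [← (Module.finBasis ℝ V).sum_dual_apply_smul_coord ξ]
  simp [dualDifferential, hF.lineDeriv_eq, mul_comm, -Module.Basis.sum_dual_apply_smul_coord]

theorem dualDifferential_dual_apply (X : V) (l : Module.Dual ℝ V) :
    dualDifferential (fun ξ : Module.Dual ℝ V => ξ X) l = X := by
  refine dualDifferential_eq fun ξ => ?_
  simp [lineDeriv]

end Calculus

/-! ### Invariance of functions of the characteristic polynomial -/

section Spectral

variable {L : Type*} [LieRing L] [LieAlgebra ℝ L] [FiniteDimensional ℝ L]

/-- The curve `t ↦ exp(t ad Y) X`. -/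
theorem exists_adjoint_flow (X Y : L) : ∃ c : ℝ → L, c 0 = X ∧
    ∀ (ξ : Module.Dual ℝ L) (t : ℝ), HasDerivAt (fun τ => ξ (c τ)) (ξ ⁅Y, c t⁆) t := by
  set e := (Module.finBasis ℝ L).equivFun
  -- In coordinates `ad Y` becomes an operator on a normed space, where the exponential can be
  -- differentiated.
  let T := (e.toLinearMap ∘ₗ (LieAlgebra.ad ℝ L Y) ∘ₗ e.symm.toLinearMap).toContinuousLinearMap
  refine ⟨fun t => e.symm (NormedSpace.exp (t • T) (e X)), by simp, fun ξ t => ?_⟩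
  have h := (hasDerivAt_exp_smul_const' (𝕂 := ℝ) T t).clm_apply (hasDerivAt_const t (e X))
  have h' := (ξ ∘ₗ e.symm.toLinearMap).toContinuousLinearMap.hasFDerivAt.comp_hasDerivAt t h
  simpa [Function.comp_def, T] using h'

-- Along the flow `ρ(c t)` satisfies a matrix Lax equation, so it stays conjugate to its initial
-- value by `exp(tρ(Y))`. The choice of matrix norm only serves to differentiate the exponential.
attribute [local instance] Matrix.linftyOpNormedRing Matrix.linftyOpNormedAlgebra in
theorem charpoly_adjoint_flow {n : ℕ} {ρ : L →ₗ[ℝ] Matrix (Fin n) (Fin n) ℂ}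
    (hρ : SymmetricPair.IsMatrixRep ρ) {Y : L} {c : ℝ → L}
    (hc : ∀ (ξ : Module.Dual ℝ L) (t : ℝ), HasDerivAt (fun τ => ξ (c τ)) (ξ ⁅Y, c t⁆) t)
    (t : ℝ) : (ρ (c t)).charpoly = (ρ (c 0)).charpoly := by
  have hρc : ∀ t, HasDerivAt (fun τ => ρ (c τ)) (ρ Y * ρ (c t) - ρ (c t) * ρ Y) t := fun t => by
    have h := (ρ ∘ₗ (Module.finBasis ℝ L).equivFun.symm.toLinearMap).toContinuousLinearMap
      |>.hasFDerivAt.comp_hasDerivAt t (hasDerivAt_equivFun (hc · t))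
    rw [← hρ]
    refine (h.congr_deriv ?_).congr_of_eventuallyEq (Filter.Eventually.of_forall fun τ => ?_)
    · exact congrArg ρ (LinearEquiv.symm_apply_apply _ _)
    · exact (congrArg ρ (LinearEquiv.symm_apply_apply _ _)).symm
  have hN : ∀ t : ℝ, HasDerivAt
      (fun τ : ℝ => NormedSpace.exp (τ • -ρ Y) * ρ (c τ) * NormedSpace.exp (τ • ρ Y)) 0 t :=
    fun t => by
      refine (((hasDerivAt_exp_smul_const (𝕂 := ℝ) (-ρ Y) t).mul (hρc t)).mul
        (hasDerivAt_exp_smul_const' (𝕂 := ℝ) (ρ Y) t)).congr_deriv ?_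
      simp only [Pi.mul_apply]
      noncomm_ring
  have h0 := is_const_of_deriv_eq_zero (fun t => (hN t).differentiableAt)
    (fun t => (hN t).deriv) t 0
  obtain ⟨u, hu⟩ := Matrix.isUnit_exp (t • ρ Y)
  have hu' : NormedSpace.exp (t • -ρ Y) = (u⁻¹ : (Matrix (Fin n) (Fin n) ℂ)ˣ).val := by
    rw [smul_neg, Matrix.exp_neg, ← hu, Matrix.coe_units_inv]
  simp only [hu', ← hu, zero_smul, NormedSpace.exp_zero, one_mul, mul_one] at h0
  rw [← h0, Matrix.coe_units_inv, Matrix.charpoly_units_conj']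

theorem contDiff_charpoly_coeff {E : Type*} [NormedAddCommGroup E] [NormedSpace ℝ E]
    [FiniteDimensional ℝ E] {n : ℕ} (φ : E →ₗ[ℝ] Matrix (Fin n) (Fin n) ℂ) (k : ℕ) :
    ContDiff ℝ ∞ fun x => (φ x).charpoly.coeff k := by
  have hφ (p : Fin n × Fin n) (x : E) : AnalyticAt ℝ (fun y => φ y p.1 p.2) x :=
    (Matrix.entryLinearMap ℝ ℂ p.1 p.2 ∘ₗ φ).toContinuousLinearMap.analyticAt x
  -- The coefficients of the characteristic polynomial are universal polynomials in the matrix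
  -- entries.
  have h (x : E) := AnalyticAt.aeval_mvPolynomial (hφ · x) ((Matrix.charpoly.univ ℂ (Fin n)).coeff k)
  refine contDiff_iff_contDiffAt.2 fun x => ((h x).contDiffAt).congr_of_eventuallyEq
    (Filter.Eventually.of_forall fun y => ?_)
  exact (Matrix.charpoly.univ_coeff_eval₂Hom (Fin n) (RingHom.id ℂ)
    (fun p : Fin n × Fin n => φ y p.1 p.2) k).symm

/-- A smooth function of the characteristic polynomial in a representation is infinitesimally
invariant under the adjoint action. -/
theorem differential_lie_of_charpoly {n : ℕ} {ρ : L →ₗ[ℝ] Matrix (Fin n) (Fin n) ℂ}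
    (hρ : SymmetricPair.IsMatrixRep ρ) {f : L → ℝ} (hf : IsSmoothFun f)
    (inv : ∀ X Y, (ρ X).charpoly = (ρ Y).charpoly → f X = f Y) (X Y : L) :
    differential f X ⁅Y, X⁆ = 0 := by
  obtain ⟨c, rfl, hc⟩ := exists_adjoint_flow X Y
  have h := hf.hasDerivAt_comp (hc · 0)
  rw [funext fun τ => inv (c τ) (c 0) (charpoly_adjoint_flow hρ hc τ)] at h
  exact h.unique (hasDerivAt_const _ _)

/-! ### Infinitesimal invariance of the spectral invariants -/

namespace SymmetricPair

/-- Chain rule along a line; it identifies the gradient of `X ↦ C(⟨X, ·⟩)` with `dC`. -/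
theorem differential_comp_form [LieAlgebra.IsSemisimple ℝ L] (D : SymmetricPair L)
    {C : Module.Dual ℝ L → ℝ} (hC : IsSmoothFun C) (X Y : L) :
    differential (fun Z => C (D.form Z)) X Y = D.form Y (dualDifferential C (D.form X)) := by
  have h := (hC.comp_linearMap D.form).hasDerivAt_comp (t := 0) (hasDerivAt_dual_line X Y · 0)
  have h' := hC.hasDerivAt_comp (t := 0) (hasDerivAt_dual_line (D.form X) (D.form Y) · 0)
  rw [apply_dualDifferential hC]
  simpa using h.unique (by simpa using h')

/-- The Casimir equation, tested on linear functions. -/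
theorem form_casimir {br : L → L → L} (D : SymmetricPair L) {C : Module.Dual ℝ L → ℝ}
    (hC : IsCasimir br C) (X Y : L) :
    D.form X (br (dualDifferential C (D.form X)) Y) = 0 := by
  have h := hC.2 _ (isSmoothFun_dual (Module.Dual.eval ℝ L Y)) (D.form X)
  simpa [liePoisson, dualDifferential_dual_apply] using h

theorem form_comm (D : SymmetricPair L) (x y : L) : D.form x y = D.form y x := by
  simp [form, LieModule.traceForm_comm ℝ L L x y]

theorem form_lie (D : SymmetricPair L) (x y z : L) : D.form ⁅x, y⁆ z = D.form x ⁅y, z⁆ := by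
  simp [form, LieModule.traceForm_apply_lie_apply]

theorem form_σ (D : SymmetricPair L) (x y : L) : D.form (D.σ x) (D.σ y) = D.form x y := by
  simp [form]

theorem IsSpectralInvariant.smooth [LieAlgebra.IsSemisimple ℝ L] {D : SymmetricPair L}
    {f : L → ℝ} (hf : D.IsSpectralInvariant f) : IsSmoothFun f := by
  cases hf with
  | coeff_re n ρ hρ k =>
    exact Complex.reCLM.contDiff.comp
      (contDiff_charpoly_coeff (ρ ∘ₗ (Module.finBasis ℝ L).equivFun.symm.toLinearMap) k)
  | coeff_im n ρ hρ k =>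
    exact Complex.imCLM.contDiff.comp
      (contDiff_charpoly_coeff (ρ ∘ₗ (Module.finBasis ℝ L).equivFun.symm.toLinearMap) k)
  | spectrum n ρ hρ f smooth inv => exact smooth
  | casimir C hC => exact hC.1.comp_linearMap D.form

theorem IsSpectralInvariant.differential_lie [LieAlgebra.IsSemisimple ℝ L] {D : SymmetricPair L}
    {f : L → ℝ} (hf : D.IsSpectralInvariant f) (X Y : L) : differential f X ⁅Y, X⁆ = 0 := by
  have smooth := hf.smooth
  cases hf with
  | coeff_re n ρ hρ k =>
    exact differential_lie_of_charpoly hρ smooth (fun X Y h => by rw [h]) X Y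
  | coeff_im n ρ hρ k =>
    exact differential_lie_of_charpoly hρ smooth (fun X Y h => by rw [h]) X Y
  | spectrum n ρ hρ f smooth inv => exact differential_lie_of_charpoly hρ smooth inv X Y
  | casimir C hC =>
    -- Invariance of the form turns `⟨[Y, X], dC⟩` into `⟨X, [dC, Y]⟩`, the Casimir equation.
    rw [D.differential_comp_form hC.1, D.form_comm, ← D.form_lie, D.form_comm]
    exact D.form_casimir hC X Y

end SymmetricPair

end Spectral

/-! ### The deformed brackets and the form -/

namespace SymmetricPair

variable {L : Type*} [LieRing L] [LieAlgebra ℝ L] [FiniteDimensional ℝ L]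

theorem projP_of_neg (D : SymmetricPair L) {x : L} (hx : D.σ x = -x) : D.projP x = x := by
  rw [projP, hx]; module

theorem projK_of_neg (D : SymmetricPair L) {x : L} (hx : D.σ x = -x) : D.projK x = 0 := by
  simp [projK, hx]

theorem projP_of_fixed (D : SymmetricPair L) {x : L} (hx : D.σ x = x) : D.projP x = 0 := by
  simp [projP, hx]

theorem projK_of_fixed (D : SymmetricPair L) {x : L} (hx : D.σ x = x) : D.projK x = x := by
  rw [projK, hx]; module

theorem projP_projP (D : SymmetricPair L) (x : L) : D.projP (D.projP x) = D.projP x :=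
  D.projP_of_neg (D.σ_projP x)

theorem projK_projP (D : SymmetricPair L) (x : L) : D.projK (D.projP x) = 0 :=
  D.projK_of_neg (D.σ_projP x)

theorem projP_projK (D : SymmetricPair L) (x : L) : D.projP (D.projK x) = 0 :=
  D.projP_of_fixed (D.σ_projK x)

theorem projK_projK (D : SymmetricPair L) (x : L) : D.projK (D.projK x) = D.projK x :=
  D.projK_of_fixed (D.σ_projK x)

/-- The projection on `𝔭` as a linear map. -/
noncomputable def projPHom (D : SymmetricPair L) : L →ₗ[ℝ] L :=
  (1 / 2 : ℝ) • (LinearMap.id - D.σ.toLinearEquiv.toLinearMap)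

/-- The projection on `𝔨` as a linear map. -/
noncomputable def projKHom (D : SymmetricPair L) : L →ₗ[ℝ] L :=
  (1 / 2 : ℝ) • (LinearMap.id + D.σ.toLinearEquiv.toLinearMap)

theorem projP_add (D : SymmetricPair L) (x y : L) :
    D.projP (x + y) = D.projP x + D.projP y := map_add D.projPHom x y

theorem projK_add (D : SymmetricPair L) (x y : L) :
    D.projK (x + y) = D.projK x + D.projK y := map_add D.projKHom x y

theorem projP_sub (D : SymmetricPair L) (x y : L) :
    D.projP (x - y) = D.projP x - D.projP y := map_sub D.projPHom x y

theorem projK_sub (D : SymmetricPair L) (x y : L) :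
    D.projK (x - y) = D.projK x - D.projK y := map_sub D.projKHom x y

theorem projP_smul (D : SymmetricPair L) (r : ℝ) (x : L) :
    D.projP (r • x) = r • D.projP x := map_smul D.projPHom r x

theorem projK_smul (D : SymmetricPair L) (r : ℝ) (x : L) :
    D.projK (r • x) = r • D.projK x := map_smul D.projKHom r x

/-- The automorphism `σ` preserves the Killing form, so `𝔭` and `𝔨` are orthogonal. -/
theorem form_eq_projP (D : SymmetricPair L) (x : L) {y : L} (hy : D.σ y = -y) :
    D.form x y = D.form (D.projP x) y := by
  have h := D.form_σ x y
  rw [hy, map_neg] at h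
  simp only [projP, map_smul, map_sub, LinearMap.smul_apply, LinearMap.sub_apply, smul_eq_mul]
  linarith

theorem form_eq_projK (D : SymmetricPair L) (x : L) {y : L} (hy : D.σ y = y) :
    D.form x y = D.form (D.projK x) y := by
  have h := D.form_σ x y
  rw [hy] at h
  simp only [projK, map_smul, map_add, LinearMap.smul_apply, LinearMap.add_apply, smul_eq_mul]
  linarith

theorem form_projP_comm (D : SymmetricPair L) (x y : L) :
    D.form (D.projP x) y = D.form x (D.projP y) := by
  rw [D.form_eq_projP x (D.σ_projP y), D.form_comm, D.form_eq_projP y (D.σ_projP x), D.form_comm]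

theorem form_projK_comm (D : SymmetricPair L) (x y : L) :
    D.form (D.projK x) y = D.form x (D.projK y) := by
  rw [D.form_eq_projK x (D.σ_projK y), D.form_comm, D.form_eq_projK y (D.σ_projK x), D.form_comm]

theorem form_lie_cyclic (D : SymmetricPair L) (x y z : L) :
    D.form x ⁅y, z⁆ = D.form y ⁅z, x⁆ := by
  rw [← D.form_lie y z x, D.form_comm]

theorem form_lie_swap (D : SymmetricPair L) (x y z : L) :
    D.form x ⁅y, z⁆ = -D.form x ⁅z, y⁆ := by
  rw [← lie_skew, map_neg]

theorem form_self_lie (D : SymmetricPair L) (x y : L) : D.form x ⁅x, y⁆ = 0 := by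
  rw [← D.form_lie, lie_self, map_zero, LinearMap.zero_apply]

theorem form_lie_self (D : SymmetricPair L) (x y : L) : D.form x ⁅y, x⁆ = 0 := by
  rw [D.form_lie_swap, form_self_lie, neg_zero]

/-- `[𝔨, 𝔭] ⊆ 𝔭`, while `[𝔨, 𝔨]` and `[𝔭, 𝔭]` lie in `𝔨`; by orthogonality each piece sees one
component of `x`. -/
theorem form_deformedBracket (D : SymmetricPair L) (s : ℝ) (x z w : L) :
    D.form x (D.deformedBracket s z w) =
      D.form (D.projP x) ⁅D.projK z, D.projP w⁆ + D.form (D.projP x) ⁅D.projP z, D.projK w⁆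
        + D.form (D.projK x) ⁅D.projK z, D.projK w⁆
        + s * D.form (D.projK x) ⁅D.projP z, D.projP w⁆ := by
  rw [deformedBracket, ← lie_skew (D.projK w)]
  simp only [map_add, map_sub, map_smul, map_neg, smul_eq_mul]
  rw [D.form_eq_projP x (y := ⁅D.projK z, D.projP w⁆) (by simp [LieEquiv.map_lie, σ_projP, σ_projK]),
    D.form_eq_projP x (y := ⁅D.projP z, D.projK w⁆) (by simp [LieEquiv.map_lie, σ_projP, σ_projK]),
    D.form_eq_projK x (y := ⁅D.projK z, D.projK w⁆) (by simp [LieEquiv.map_lie, σ_projK]),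
    D.form_eq_projK x (y := ⁅D.projP z, D.projP w⁆) (by simp [LieEquiv.map_lie, σ_projP])]
  ring

theorem form_deformedBracket_swap (D : SymmetricPair L) (s : ℝ) (x z w : L) :
    D.form x (D.deformedBracket s z w) = -D.form x (D.deformedBracket s w z) := by
  rw [form_deformedBracket, form_deformedBracket, D.form_lie_swap _ (D.projK z) (D.projP w),
    D.form_lie_swap _ (D.projP z) (D.projK w), D.form_lie_swap _ (D.projK z) (D.projK w),
    D.form_lie_swap _ (D.projP z) (D.projP w)]
  ring

/-- `Y ↦ ⟨x, [z, Y]_s⟩` as a linear form. -/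
noncomputable def coadjoint (D : SymmetricPair L) (s : ℝ) (x z : L) : Module.Dual ℝ L where
  toFun w := D.form x (D.deformedBracket s z w)
  map_add' v w := by
    simp only [form_deformedBracket, projP_add, projK_add, lie_add, map_add]
    ring
  map_smul' r w := by
    simp only [form_deformedBracket, projP_smul, projK_smul, lie_smul, map_smul, smul_eq_mul,
      RingHom.id_apply]
    ring

theorem coadjoint_apply (D : SymmetricPair L) (s : ℝ) (x z w : L) :
    D.coadjoint s x z w = D.form x (D.deformedBracket s z w) := rfl

theorem spectralMatrix_projP (D : SymmetricPair L) {A : L} (hA : D.σ A = -A) (s μ : ℝ) (X : L) :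
    D.projP (D.spectralMatrix A s μ X) = D.projP X + (μ ^ 2 - s) • A := by
  simp [spectralMatrix, projP_add, projP_sub, projP_smul, projP_projP, projP_projK,
    D.projP_of_neg hA]

theorem spectralMatrix_projK (D : SymmetricPair L) {A : L} (hA : D.σ A = -A) (s μ : ℝ) (X : L) :
    D.projK (D.spectralMatrix A s μ X) = -(μ • D.projK X) := by
  simp [spectralMatrix, projK_add, projK_sub, projK_smul, projK_projP, projK_projK,
    D.projK_of_neg hA]

/-! ### Gradients and differentials -/

section Sharp

variable [LieAlgebra.IsSemisimple ℝ L]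

theorem sharp_eq (D : SymmetricPair L) {l : Module.Dual ℝ L} {x : L}
    (h : ∀ y, D.form x y = l y) : D.sharp l = x := by
  rw [sharp, LinearEquiv.symm_apply_eq]
  ext y
  rw [← h, LinearMap.BilinForm.toDual_def]

/-- The linear part of `l ↦ L_μ` is symmetric. -/
theorem apply_shift (D : SymmetricPair L) (l ξ : Module.Dual ℝ L) (μ : ℝ) :
    ξ (D.projP (D.sharp l) - μ • D.projK (D.sharp l)) =
      l (D.projP (D.sharp ξ) - μ • D.projK (D.sharp ξ)) := by
  simp only [← D.form_sharp ξ, ← D.form_sharp l, map_sub, map_smul, ← form_projP_comm,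
    ← form_projK_comm]
  rw [D.form_comm _ (D.sharp l), D.form_comm _ (D.sharp l), form_projP_comm, form_projK_comm]

/-- The gradient of a function with respect to the form. -/
noncomputable def gradient (D : SymmetricPair L) (f : L → ℝ) (X : L) : L :=
  D.sharp (differential f X)

theorem form_gradient (D : SymmetricPair L) (f : L → ℝ) (X Y : L) :
    D.form (D.gradient f X) Y = differential f X Y := D.form_sharp _ _

theorem spectralMatrix_line (D : SymmetricPair L) (A : L) (s μ : ℝ) (l ξ : Module.Dual ℝ L)
    (t : ℝ) : D.spectralMatrix A s μ (D.sharp (l + t • ξ)) =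
      D.spectralMatrix A s μ (D.sharp l) +
        t • (D.projP (D.sharp ξ) - μ • D.projK (D.sharp ξ)) := by
  simp only [spectralMatrix, map_add, map_smul, projP_add, projP_smul, projK_add, projK_smul]
  module

/-- The symmetric linear part of `L ↦ L_μ` passes from the direction `ξ` to the gradient; the
constant `(μ² - s)A` drops out. -/
theorem dualDifferential_spectralFunction (D : SymmetricPair L) (A : L) (s μ : ℝ) {f : L → ℝ}
    (hf : IsSmoothFun f) (l : Module.Dual ℝ L) :
    dualDifferential (D.spectralFunction A s μ f) l =
      D.projP (D.gradient f (D.spectralMatrix A s μ (D.sharp l))) -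
        μ • D.projK (D.gradient f (D.spectralMatrix A s μ (D.sharp l))) := by
  refine dualDifferential_eq fun ξ => ?_
  rw [gradient, apply_shift, ← hf.lineDeriv_eq, lineDeriv, lineDeriv]
  simp only [spectralFunction, spectralMatrix_line]

theorem dualDifferential_affineHamiltonian (D : SymmetricPair L) {A : L} (hA : D.σ A = -A)
    (l : Module.Dual ℝ L) :
    dualDifferential (D.affineHamiltonian A) l = D.projK (D.sharp l) + A := by
  refine dualDifferential_eq fun ξ => ?_
  set x := D.sharp l
  set y := D.sharp ξ
  -- Along a line `H` is a quadratic polynomial in `t`, and its linear coefficient is the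
  -- derivative.
  have h : (fun t : ℝ => D.affineHamiltonian A (l + t • ξ)) = fun t =>
      D.affineHamiltonian A l + t * (D.form (D.projK x) (D.projK y) + D.form A (D.projP y))
        + t ^ 2 * (1 / 2 * D.form (D.projK y) (D.projK y)) := by
    funext t
    simp only [affineHamiltonian, map_add, map_smul, projK_add, projK_smul, projP_add, projP_smul,
      LinearMap.add_apply, LinearMap.smul_apply, smul_eq_mul, D.form_comm (D.projK (D.sharp ξ))
      (D.projK (D.sharp l)), x, y]
    ring
  have h' : HasDerivAt (fun t : ℝ => D.affineHamiltonian A (l + t • ξ))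
      (D.form (D.projK x) (D.projK y) + D.form A (D.projP y)) 0 := by
    rw [h]
    refine ((((hasDerivAt_id (0 : ℝ)).mul_const _).const_add _).add
      (((hasDerivAt_id (0 : ℝ)).pow 2).mul_const _)).congr_deriv ?_
    simp
  rw [lineDeriv, h'.deriv, ← D.form_sharp ξ, D.form_comm _ (_ + A), map_add, LinearMap.add_apply,
    ← form_projK_comm, projK_projK, ← form_projP_comm, D.projP_of_neg hA]

/-- Smooth functions on `L`, identified with its dual, whose differential satisfies the Casimir
equation of the bracket `[ , ]_r`. -/
structure IsInvariant (D : SymmetricPair L) (r : ℝ) (f : L → ℝ) : Prop where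
  smooth : IsSmoothFun f
  form_gradient_lie (X U : L) : D.form X (D.deformedBracket r (D.gradient f X) U) = 0

theorem IsSpectralInvariant.isInvariant {D : SymmetricPair L} {f : L → ℝ}
    (hf : D.IsSpectralInvariant f) : D.IsInvariant 1 f where
  smooth := hf.smooth
  form_gradient_lie X U := by
    rw [deformedBracket_one, form_lie_cyclic, form_gradient, hf.differential_lie]

theorem IsCasimir.isInvariant {D : SymmetricPair L} {r : ℝ} {C : Module.Dual ℝ L → ℝ}
    (hC : IsCasimir (D.deformedBracket r) C) : D.IsInvariant r fun X => C (D.form X) where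
  smooth := hC.1.comp_linearMap D.form
  form_gradient_lie X U := by
    rw [gradient, D.sharp_eq (x := dualDifferential C (D.form X)), D.form_casimir hC]
    intro y
    rw [D.differential_comp_form hC.1, D.form_comm]

/-! ### Poisson commutation -/

variable {D : SymmetricPair L} {A : L} {r s : ℝ} {f g : L → ℝ}

/-- This is the invariance equation at `L_μ`, whose components are `X_𝔭 + (μ² - s)A` and `-μ X_𝔨`.
The factor `r` comes from the `[𝔭, 𝔭]` term, which vanishes when `U` is in `𝔨`. -/
theorem IsInvariant.lie_projP (hf : D.IsInvariant r f) (hA : D.σ A = -A) (μ : ℝ) (X : L) {U : L}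
    (hU : D.σ U = -U) :
    D.form (D.projP X) ⁅D.projK (D.gradient f (D.spectralMatrix A s μ X)), U⁆ +
      (μ ^ 2 - s) * D.form A ⁅D.projK (D.gradient f (D.spectralMatrix A s μ X)), U⁆ =
      r * μ * D.form (D.projK X) ⁅D.projP (D.gradient f (D.spectralMatrix A s μ X)), U⁆ := by
  have h := hf.form_gradient_lie (D.spectralMatrix A s μ X) U
  rw [form_deformedBracket, D.spectralMatrix_projP hA, D.spectralMatrix_projK hA,
    D.projP_of_neg hU, D.projK_of_neg hU] at h
  simp only [map_add, map_neg, map_smul, LinearMap.add_apply, LinearMap.neg_apply,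
    LinearMap.smul_apply, smul_eq_mul, lie_zero, map_zero] at h
  linarith

theorem IsInvariant.lie_projK (hf : D.IsInvariant r f) (hA : D.σ A = -A) (μ : ℝ) (X : L) {U : L}
    (hU : D.σ U = U) :
    D.form (D.projP X) ⁅D.projP (D.gradient f (D.spectralMatrix A s μ X)), U⁆ +
      (μ ^ 2 - s) * D.form A ⁅D.projP (D.gradient f (D.spectralMatrix A s μ X)), U⁆ =
      μ * D.form (D.projK X) ⁅D.projK (D.gradient f (D.spectralMatrix A s μ X)), U⁆ := by
  have h := hf.form_gradient_lie (D.spectralMatrix A s μ X) U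
  rw [form_deformedBracket, D.spectralMatrix_projP hA, D.spectralMatrix_projK hA,
    D.projP_of_fixed hU, D.projK_of_fixed hU] at h
  simp only [map_add, map_neg, map_smul, LinearMap.add_apply, LinearMap.neg_apply,
    LinearMap.smul_apply, smul_eq_mul, lie_zero, map_zero] at h
  linarith

theorem liePoisson_eq_form (br : L → L → L) (F G : Module.Dual ℝ L → ℝ) (l : Module.Dual ℝ L) :
    liePoisson br F G l =
      D.form (D.sharp l) (br (dualDifferential F l) (dualDifferential G l)) :=
  (D.form_sharp _ _).symm

theorem liePoisson_spectralFunction_of_sq_ne (hA : D.σ A = -A) (hr : s * r = s)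
    (hf : D.IsInvariant r f) (hg : D.IsInvariant r g) {μ ν : ℝ} (hμν : μ ^ 2 ≠ ν ^ 2)
    (l : Module.Dual ℝ L) :
    liePoisson (D.deformedBracket s) (D.spectralFunction A s μ f)
      (D.spectralFunction A s ν g) l = 0 := by
  rw [liePoisson_eq_form (D := D), D.dualDifferential_spectralFunction A s μ hf.smooth,
    D.dualDifferential_spectralFunction A s ν hg.smooth, form_deformedBracket]
  set X := D.sharp l
  have h1 := hf.lie_projP (s := s) hA μ X
    (D.σ_projP (D.gradient g (D.spectralMatrix A s ν X)))
  have h2 := hf.lie_projK (s := s) hA μ X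
    (D.σ_projK (D.gradient g (D.spectralMatrix A s ν X)))
  have h3 := hg.lie_projP (s := s) hA ν X
    (D.σ_projP (D.gradient f (D.spectralMatrix A s μ X)))
  have h4 := hg.lie_projK (s := s) hA ν X
    (D.σ_projK (D.gradient f (D.spectralMatrix A s μ X)))
  set Z := D.gradient f (D.spectralMatrix A s μ X)
  set W := D.gradient g (D.spectralMatrix A s ν X)
  simp only [D.form_lie_swap _ (D.projK W), D.form_lie_swap _ (D.projP W)] at h3 h4
  simp only [projP_sub, projK_sub, projP_smul, projK_smul, projP_projP, projK_projP, projP_projK,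
    projK_projK, smul_zero, zero_sub, sub_zero, neg_lie, lie_neg, smul_lie, lie_smul, map_neg,
    map_smul, smul_eq_mul]
  generalize D.form (D.projK X) ⁅D.projK Z, D.projK W⁆ = a at *
  generalize D.form (D.projK X) ⁅D.projP Z, D.projP W⁆ = b at *
  generalize D.form (D.projP X) ⁅D.projK Z, D.projP W⁆ = c at *
  generalize D.form (D.projP X) ⁅D.projP Z, D.projK W⁆ = d at *
  generalize D.form A ⁅D.projK Z, D.projP W⁆ = e at *
  generalize D.form A ⁅D.projP Z, D.projK W⁆ = h at *
  -- The bracket is now `μν a - μ c - ν d + s b`. Eliminating `e` from `h1`, `h4` and `h` from `h2`,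
  -- `h3` gives `μ c + ν d = μν a + s r b` times `μ² - ν²`, and `s r = s` finishes.
  refine (mul_eq_zero.1 (?_ : (μ ^ 2 - ν ^ 2) * _ = 0)).resolve_left (sub_ne_zero.2 hμν)
  linear_combination (μ * (ν ^ 2 - s)) * h1 + (μ * (μ ^ 2 - s)) * h4
    + (ν * (ν ^ 2 - s)) * h2 + (ν * (μ ^ 2 - s)) * h3 + (b * (ν ^ 2 - μ ^ 2)) * hr

theorem liePoisson_spectralFunction (hA : D.σ A = -A) (hr : s * r = s)
    (hf : D.IsInvariant r f) (hg : D.IsInvariant r g) (μ ν : ℝ) (l : Module.Dual ℝ L) :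
    liePoisson (D.deformedBracket s) (D.spectralFunction A s μ f)
      (D.spectralFunction A s ν g) l = 0 := by
  set w := dualDifferential (D.spectralFunction A s ν g) l with hw
  set X := D.sharp l with hX
  have hS (ξ : Module.Dual ℝ L) : Continuous fun κ => ξ (D.spectralMatrix A s κ X) := by
    simp only [spectralMatrix, map_add, map_sub, map_smul, smul_eq_mul]
    fun_prop
  have hφ (φ : Module.Dual ℝ L) :
      Continuous fun κ => φ (D.gradient f (D.spectralMatrix A s κ X)) := by
    simp only [← D.form_sharp φ, D.form_comm (D.sharp φ), form_gradient]
    exact hf.smooth.continuous_differential hS _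
  have hcont : Continuous fun κ => liePoisson (D.deformedBracket s)
      (D.spectralFunction A s κ f) (D.spectralFunction A s ν g) l := by
    -- With the fixed differential `w` in the first slot, the bracket is, up to sign, one fixed
    -- linear form applied to `Z_𝔭 - κ Z_𝔨`, where the gradient `Z` varies continuously with `κ`.
    have h := (hφ (D.coadjoint s X w ∘ₗ D.projPHom)).sub
      (continuous_id.mul (hφ (D.coadjoint s X w ∘ₗ D.projKHom)))
    refine h.neg.congr fun κ => ?_
    rw [liePoisson_eq_form (D := D), form_deformedBracket_swap, ← coadjoint_apply,
      D.dualDifferential_spectralFunction A s κ hf.smooth, map_sub, map_smul]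
    rfl
  have hdense : Dense ({ν, -ν}ᶜ : Set ℝ) :=
    ((Set.finite_singleton (-ν)).insert ν).countable.dense_compl ℝ
  refine congrFun (hcont.ext_on hdense (continuous_const (y := (0 : ℝ))) fun κ hκ => ?_) μ
  refine liePoisson_spectralFunction_of_sq_ne hA hr hf hg (fun h => hκ ?_) l
  simpa using sq_eq_sq_iff_eq_or_eq_neg.1 h

theorem liePoisson_spectralFunction_affineHamiltonian (hA : D.σ A = -A) (hf : D.IsInvariant 1 f)
    (μ : ℝ) (l : Module.Dual ℝ L) :
    liePoisson (D.deformedBracket s) (D.spectralFunction A s μ f) (D.affineHamiltonian A) l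
      = 0 := by
  rw [liePoisson_eq_form (D := D), D.dualDifferential_spectralFunction A s μ hf.smooth,
    D.dualDifferential_affineHamiltonian hA, form_deformedBracket]
  set X := D.sharp l
  have h1 := hf.lie_projP (s := s) hA μ X hA
  have h2 := hf.lie_projK (s := s) hA μ X (D.σ_projK X)
  set Z := D.gradient f (D.spectralMatrix A s μ X)
  -- The terms `⟨A, [Z_𝔨, A]⟩` and `⟨X_𝔨, [Z_𝔨, X_𝔨]⟩` vanish.
  rw [form_lie_self] at h1 h2
  rw [D.form_lie_cyclic A, D.form_lie_cyclic (D.projP Z) _ A, D.form_lie_swap _ A] at h2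
  simp only [projP_sub, projK_sub, projP_smul, projK_smul, projP_projP, projK_projP, projP_projK,
    projK_projK, smul_zero, zero_sub, sub_zero, neg_lie, smul_lie, map_neg, projP_add, projK_add,
    D.projP_of_neg hA, D.projK_of_neg hA, add_zero, zero_add, form_lie_self,
    map_smul, smul_eq_mul]
  linear_combination h2 - μ * h1

/-! ### The flow of the affine Hamiltonian -/

theorem hasDerivAt_apply_spectralMatrix {I : Set ℝ} {l : ℝ → Module.Dual ℝ L}
    (hA : D.σ A = -A)
    (hl : IsHamiltonianCurve (D.deformedBracket s) (D.affineHamiltonian A) I l) {t : ℝ}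
    (ht : t ∈ I) (μ : ℝ) (ξ : Module.Dual ℝ L) :
    HasDerivAt (fun τ => ξ (D.spectralMatrix A s μ (D.sharp (l τ))))
      (-D.coadjoint s (D.sharp (l t)) (D.projK (D.sharp (l t)) + A)
        (D.projP (D.sharp ξ) - μ • D.projK (D.sharp ξ))) t := by
  -- By symmetry of the linear part, differentiating `ξ(L_μ)` amounts to testing Hamilton's equation
  -- on the shifted vector of `ξ`.
  have h := (hl t ht (D.projP (D.sharp ξ) - μ • D.projK (D.sharp ξ))).add_const
    (ξ ((μ ^ 2 - s) • A))
  rw [D.dualDifferential_affineHamiltonian hA, ← D.form_sharp (l t)] at h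
  refine h.congr_of_eventuallyEq (Filter.Eventually.of_forall fun τ => ?_)
  beta_reduce
  rw [← apply_shift, ← map_add]
  rfl

theorem hasDerivAt_spectralMatrix_lax {I : Set ℝ} {l : ℝ → Module.Dual ℝ L} (hA : D.σ A = -A)
    (hl : IsHamiltonianCurve (D.deformedBracket s) (D.affineHamiltonian A) I l) {t : ℝ}
    (ht : t ∈ I) {μ : ℝ} (hμ : μ ≠ 0) (ξ : Module.Dual ℝ L) :
    HasDerivAt (fun τ => ξ (D.spectralMatrix A s μ (D.sharp (l τ))))
      (ξ ⁅D.laxMatrix A s μ (D.sharp (l t)), D.spectralMatrix A s μ (D.sharp (l t))⁆) t := by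
  refine (hasDerivAt_apply_spectralMatrix hA hl ht μ ξ).congr_deriv ?_
  set X := D.sharp (l t)
  -- The `[X_𝔭, A]` terms have coefficient `μ⁻¹((μ² - s) + s) = μ`, so the pole at `μ = 0` cancels.
  have hlax : ⁅D.laxMatrix A s μ X, D.spectralMatrix A s μ X⁆ =
      ⁅D.projK X, D.projP X⁆ + s • ⁅A, D.projK X⁆ - μ • ⁅A, D.projP X⁆ := by
    rw [← lie_skew A (D.projP X), ← lie_skew (D.projK X)]
    simp only [laxMatrix, spectralMatrix, sub_lie, smul_lie, lie_add, lie_sub, lie_smul, lie_self]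
    rw [← lie_skew A (D.projP X)]
    match_scalars <;> field
  rw [hlax, coadjoint_apply, form_deformedBracket, ← D.form_sharp ξ]
  set y := D.sharp ξ
  simp only [map_add, map_sub, map_smul, smul_eq_mul]
  rw [D.form_eq_projP y (y := ⁅D.projK X, D.projP X⁆)
      (by simp [LieEquiv.map_lie, σ_projP, σ_projK]),
    D.form_eq_projP y (y := ⁅A, D.projK X⁆) (by simp [LieEquiv.map_lie, hA, σ_projK]),
    D.form_eq_projK y (y := ⁅A, D.projP X⁆) (by simp [LieEquiv.map_lie, hA, σ_projP])]
  simp only [projP_sub, projK_sub, projP_smul, projK_smul, projP_projP, projK_projP, projP_projK,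
    projK_projK, smul_zero, zero_sub, sub_zero, lie_neg, lie_smul, map_neg, projP_add, projK_add,
    D.projP_of_neg hA, D.projK_of_neg hA, add_zero, zero_add, form_self_lie,
    map_smul, smul_eq_mul]
  linear_combination
    -(D.form_lie_cyclic (D.projP X) (D.projK X) (D.projP y)).trans
        ((D.form_lie_cyclic _ _ _).trans (D.form_lie_swap _ _ _))
      + μ * (D.form_lie_cyclic (D.projP X) A (D.projK y)).trans
        ((D.form_lie_cyclic _ _ _).trans (D.form_lie_swap _ _ _))
      - s * (D.form_lie_cyclic (D.projK X) A (D.projP y)).trans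
        ((D.form_lie_cyclic _ _ _).trans (D.form_lie_swap _ _ _))

theorem spectralFunction_eq_of_isHamiltonianCurve {I : Set ℝ} {l : ℝ → Module.Dual ℝ L}
    (hA : D.σ A = -A) (hI : IsOpen I) (hI' : I.OrdConnected)
    (hl : IsHamiltonianCurve (D.deformedBracket s) (D.affineHamiltonian A) I l)
    (hf : D.IsInvariant 1 f) (μ : ℝ) {t₁ t₂ : ℝ} (h₁ : t₁ ∈ I) (h₂ : t₂ ∈ I) :
    D.spectralFunction A s μ f (l t₁) = D.spectralFunction A s μ f (l t₂) := by
  have h (t : ℝ) (ht : t ∈ I) :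
      HasDerivAt (fun τ => D.spectralFunction A s μ f (l τ)) 0 t := by
    -- `η` is the velocity of `l`; pairing it with the differential of `f(L_μ)` gives `{F, H}_s`, so
    -- the Lax equation is not needed and `μ = 0` is allowed.
    set η := -D.coadjoint s (D.sharp (l t)) (D.projK (D.sharp (l t)) + A)
    have h' := hf.smooth.hasDerivAt_comp
      (v := D.projP (D.sharp η) - μ • D.projK (D.sharp η)) fun ξ =>
        (hasDerivAt_apply_spectralMatrix hA hl ht μ ξ).congr_deriv (D.apply_shift η ξ μ).symm
    refine h'.congr_deriv ?_
    have hF := liePoisson_spectralFunction_affineHamiltonian (s := s) hA hf μ (l t)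
    rw [liePoisson_eq_form (D := D), form_deformedBracket_swap,
      D.dualDifferential_affineHamiltonian hA, ← coadjoint_apply,
      D.dualDifferential_spectralFunction A s μ hf.smooth, gradient] at hF
    rw [D.apply_shift η]
    exact hF
  exact hI.is_const_of_deriv_eq_zero hI'.isPreconnected
    (fun t ht => (h t ht).differentiableAt.differentiableWithinAt)
    (fun t ht => (h t ht).deriv) h₁ h₂

end Sharp

end SymmetricPair

/-- `s = 1` is the semisimple case and `s = 0` the semidirect case. -/
theorem proposition5p1 {L : Type*} [LieRing L] [LieAlgebra ℝ L] [FiniteDimensional ℝ L]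
    [LieAlgebra.IsSemisimple ℝ L] (D : SymmetricPair L) (A : L) (hA : D.σ A = -A)
    (s : ℝ) (hs : s = 1 ∨ s = 0) :
    -- the spectral invariants of `L_μ` Poisson commute with each other
    (∀ f g : L → ℝ, D.IsSpectralInvariant f → D.IsSpectralInvariant g →
      ∀ (μ ν : ℝ) (l : Module.Dual ℝ L),
        liePoisson (D.deformedBracket s) (D.spectralFunction A s μ f)
          (D.spectralFunction A s ν g) l = 0) ∧
    -- and so do the shifts `l ↦ C(⟨L_μ, ·⟩)` of the Casimirs `C` of the bracket `[ , ]_s` itself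
    (∀ C C' : Module.Dual ℝ L → ℝ, IsCasimir (D.deformedBracket s) C →
      IsCasimir (D.deformedBracket s) C' → ∀ (μ ν : ℝ) (l : Module.Dual ℝ L),
        liePoisson (D.deformedBracket s) (D.spectralFunction A s μ (fun X => C (D.form X)))
          (D.spectralFunction A s ν (fun X => C' (D.form X))) l = 0) ∧
    -- the spectral invariants of `L_μ` Poisson commute with the affine Hamiltonian
    (∀ f : L → ℝ, D.IsSpectralInvariant f → ∀ (μ : ℝ) (l : Module.Dual ℝ L),
      liePoisson (D.deformedBracket s) (D.spectralFunction A s μ f)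
        (D.affineHamiltonian A) l = 0) ∧
    -- along each integral curve of the affine Hamiltonian
    (∀ (I : Set ℝ) (l : ℝ → Module.Dual ℝ L), IsOpen I → I.OrdConnected →
      IsHamiltonianCurve (D.deformedBracket s) (D.affineHamiltonian A) I l →
      -- the Lax equation `dL_μ/dt = [M_μ, L_μ]` holds
      (∀ μ : ℝ, μ ≠ 0 → ∀ t ∈ I, ∀ ξ : Module.Dual ℝ L,
        HasDerivAt (fun τ => ξ (D.spectralMatrix A s μ (D.sharp (l τ))))
          (ξ ⁅D.laxMatrix A s μ (D.sharp (l t)),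
            D.spectralMatrix A s μ (D.sharp (l t))⁆) t) ∧
      -- and the spectral invariants of `L_μ` are constant
      (∀ f : L → ℝ, D.IsSpectralInvariant f → ∀ μ : ℝ, ∀ t₁ ∈ I, ∀ t₂ ∈ I,
        D.spectralFunction A s μ f (l t₁) = D.spectralFunction A s μ f (l t₂))) := by
  refine ⟨fun f g hf hg μ ν l => ?_, fun C C' hC hC' μ ν l => ?_, fun f hf μ l => ?_,
    fun I l hI hI' hl => ⟨fun μ hμ t ht ξ => ?_, fun f hf μ t₁ h₁ t₂ h₂ => ?_⟩⟩
  · exact SymmetricPair.liePoisson_spectralFunction hA (mul_one s) hf.isInvariant hg.isInvariant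
      μ ν l
  · refine SymmetricPair.liePoisson_spectralFunction (r := s) hA ?_
      (SymmetricPair.IsCasimir.isInvariant hC) (SymmetricPair.IsCasimir.isInvariant hC') μ ν l
    -- Here `r = s`, so the condition becomes `s² = s`; only this step uses `s ∈ {0, 1}`.
    rcases hs with rfl | rfl <;> simp
  · exact SymmetricPair.liePoisson_spectralFunction_affineHamiltonian hA hf.isInvariant μ l
  · exact SymmetricPair.hasDerivAt_spectralMatrix_lax hA hl ht hμ ξ
  · exact SymmetricPair.spectralFunction_eq_of_isHamiltonianCurve hA hI hI' hl hf.isInvariant μ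
      h₁ h₂
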